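/- All rings are commutative with $1$. For a finite sequence $\mathbf x = x_1,\dots,x_\ell$ in a ring $R$ let $C(\mathbf x)=\bigotimes_j(0\to R\to R_{x_j}\to 0)$ be the Čech complex, with cohomology $H^i_{\mathbf x}(R)$, and let $H_i(\mathbf x)$ be the homology of the Koszul complex $K(\mathbf x)=\bigotimes_j(0\to R\xrightarrow{x_j}R\to 0)$. The sequence $\mathbf x$ is *weakly proregular* if for each $n$ there is $m\ge n$ such that the natural maps $H_i(x_1^m,\dots,x_\ell^m)\to H_i(x_1^n,\dots,x_\ell^n)$ (induced by the tensor product of the maps that are $x_j^{m-n}$ in degree $1$ and the identity in degree $0$) vanish for all $i\ge 1$. It is a *parameter sequence* on $R$ if it is weakly proregular, $(\mathbf x)R\ne R$, and $H^{\ell}_{\mathbf x}(R)_p\ne 0$ for every prime $p\supseteq(\mathbf x)R$. It is a *strong parameter sequence* if $x_1,\dots,x_i$ is a parameter sequence for $i=1,\dots,\ell$. The sequence is *regular* if each $x_i$ is a non-zero-divisor on $R/(x_1,\dots,x_{i-1})R$ and $(\mathbf x)R\neq R$; the empty sequence is regular on every ring by convention. A (not necessarily Noetherian) ring is *Cohen–Macaulay*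 if every strong parameter sequence on it is a regular sequence. Let $R=\mathbb C+x\,\mathbb C[[x,y]]\subseteq\mathbb C[[x,y]]$. Then: 1. $R$ is an integral domain with a unique maximal ideal (quasi-local), has Krull dimension $2$, and is Cohen–Macaulay. 2. $xy\in R$ is a non-zero-divisor of $R$, and $R/xyR$ is not Cohen–Macaulay. Consequently it is not true that for every Cohen–Macaulay ring $A$ and every non-zero-divisor $a\in A$ the ring $A/aA$ is Cohen–Macaulay. -/

import Mathlib

/-! ### Koszul complex and weakly proregular sequences

For `x₁, …, xₙ` in a commutative ring `R`, the tensor product of the complexes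
`0 → R → R → 0` (multiplication by `xⱼ`) is written out in its standard basis: in degree `i` it is
the free module on the `i`-element subsets of the index set. -/

section Koszul

variable {R : Type*} [CommRing R] {n : ℕ}

/-- The sign `(-1) ^ #{k ∈ s | k < j}`. -/
def complexSign (s : Finset (Fin n)) (j : Fin n) : ℤ :=
  (-1) ^ (s.filter (fun k => k < j)).card

variable (R n) in
/-- The module in degree `i` of the Koszul complex of `n` elements of `R`. -/
abbrev KoszulModule (i : ℕ) : Type _ :=
  {s : Finset (Fin n) // s.card = i} → R

/-- The Koszul differential `K_{i+1}(x) → K_i(x)`. -/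
def koszulD (x : Fin n → R) (i : ℕ) : KoszulModule R n (i + 1) →ₗ[R] KoszulModule R n i where
  toFun f s := ∑ j : {j : Fin n // j ∉ s.1},
    complexSign s.1 j.1 • (x j.1 * f ⟨insert j.1 s.1, by
      rw [Finset.card_insert_of_notMem j.2, s.2]⟩)
  map_add' f g := by
    funext s
    simp only [Pi.add_apply, mul_add, smul_add, Finset.sum_add_distrib]
  map_smul' r f := by
    funext s
    simp only [Pi.smul_apply, smul_eq_mul, RingHom.id_apply, Finset.mul_sum]
    refine Finset.sum_congr rfl fun j _ => ?_
    rw [mul_smul_comm, mul_left_comm]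

theorem complexSign_swap (s : Finset (Fin n)) {j k : Fin n} (hj : j ∉ s) (hk : k ∉ s) (h : j ≠ k) :
    complexSign s j * complexSign (insert j s) k = -(complexSign s k * complexSign (insert k s) j) := by
  unfold complexSign
  rcases lt_or_gt_of_ne h with h | h
  · have h' := not_lt.mpr h.le
    simp only [Finset.filter_insert, h, h', if_true, if_false]
    rw [Finset.card_insert_of_notMem (by simp [hj])]
    ring
  · have h' := not_lt.mpr h.le
    simp only [Finset.filter_insert, h, h', if_true, if_false]
    rw [Finset.card_insert_of_notMem (by simp [hk])]
    ring

theorem koszulD_comp (x : Fin n → R) (i : ℕ) (f : KoszulModule R n (i+2)) :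
    koszulD x i (koszulD x (i+1) f) = 0 := by
  funext s
  simp only [koszulD, LinearMap.coe_mk, AddHom.coe_mk, Finset.mul_sum, Finset.smul_sum, Pi.zero_apply]
  rw [Finset.sum_sigma']
  refine Finset.sum_involution
    (fun a _ => ⟨⟨a.2.1, fun h => a.2.2 (Finset.mem_insert_of_mem h)⟩, ⟨a.1.1, fun h => by
      rcases Finset.mem_insert.1 h with h | h
      · exact a.2.2 (Finset.mem_insert.2 (Or.inl h.symm))
      · exact a.1.2 h⟩⟩) ?_ ?_ ?_ ?_
  · rintro ⟨⟨j, hj⟩, ⟨k, hk⟩⟩ -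
    have hks : k ∉ s.1 := fun h => hk (Finset.mem_insert_of_mem h)
    have hjk : j ≠ k := fun h => hk (Finset.mem_insert.2 (Or.inl h.symm))
    have e := complexSign_swap s.1 hj hks hjk
    have key : ∀ (w w' : Finset (Fin n)) (_ : w = w') (c : w.card = i + 2) (c' : w'.card = i + 2),
        f ⟨w, c⟩ = f ⟨w', c'⟩ := by
      rintro w w' rfl c c'
      rfl
    dsimp only
    rw [key _ _ (Finset.insert_comm k j s.1) _ (by
      rw [Finset.insert_comm, Finset.card_insert_of_notMem hk, Finset.card_insert_of_notMem hj, s.2])]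
    rw [mul_smul_comm, smul_smul, e, mul_smul_comm, smul_smul, mul_left_comm (x j), neg_smul,
      neg_add_cancel]
  · rintro ⟨⟨j, hj⟩, ⟨k, hk⟩⟩ - - h
    have : k = j := by simpa using congrArg (fun a => a.1.1) h
    exact hk (Finset.mem_insert.2 (Or.inl this))
  · intros; simp
  · rintro ⟨⟨j, hj⟩, ⟨k, hk⟩⟩ -; rfl

/-- The cycles of degree `i` of the Koszul complex. -/
def koszulCycles (x : Fin n → R) : (i : ℕ) → Submodule R (KoszulModule R n i)
  | 0 => ⊤
  | i + 1 => LinearMap.ker (koszulD x i)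

/-- The boundaries of degree `i` of the Koszul complex. -/
def koszulBoundaries (x : Fin n → R) (i : ℕ) : Submodule R (KoszulModule R n i) :=
  LinearMap.range (koszulD x i)

/-- The Koszul homology `H_i(x)`. -/
abbrev KoszulHomology (x : Fin n → R) (i : ℕ) : Type _ :=
  koszulCycles x i ⧸ (koszulBoundaries x i).submoduleOf (koszulCycles x i)

/-- The degree `i` part of the chain map `K(x₁ᵐ, …, xₙᵐ) → K(x₁ᵏ, …, xₙᵏ)`, for `k ≤ m`, that is the
tensor product of the maps which are the identity in degree `0` and multiplication by `xⱼ ^ (m - k)`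
in degree `1`. -/
def koszulPowMap (x : Fin n → R) (m k i : ℕ) : KoszulModule R n i →ₗ[R] KoszulModule R n i where
  toFun f s := (∏ j ∈ s.1, x j ^ (m - k)) * f s
  map_add' f g := by
    funext s
    simp only [Pi.add_apply, mul_add]
  map_smul' r f := by
    funext s
    simp only [Pi.smul_apply, smul_eq_mul, RingHom.id_apply, mul_left_comm]

theorem koszulPowMap_comm (x : Fin n → R) {m k : ℕ} (h : k ≤ m) (i : ℕ)
    (f : KoszulModule R n (i + 1)) :
    koszulD (fun j => x j ^ k) i (koszulPowMap x m k (i + 1) f) =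
      koszulPowMap x m k i (koszulD (fun j => x j ^ m) i f) := by
  funext s
  simp only [koszulD, koszulPowMap, LinearMap.coe_mk, AddHom.coe_mk, Finset.mul_sum]
  refine Finset.sum_congr rfl fun j _ => ?_
  rw [Finset.prod_insert j.2, mul_smul_comm]
  congr 1
  have e : x j.1 ^ m = x j.1 ^ k * x j.1 ^ (m - k) := by rw [← pow_add, Nat.add_sub_cancel' h]
  rw [e]
  ring

theorem koszulPowMap_mem_cycles (x : Fin n → R) {m k : ℕ} (h : k ≤ m) (i : ℕ)
    (f : KoszulModule R n i) (hf : f ∈ koszulCycles (fun j => x j ^ m) i) :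
    koszulPowMap x m k i f ∈ koszulCycles (fun j => x j ^ k) i := by
  cases i with
  | zero => exact Submodule.mem_top
  | succ i =>
    have hf' : koszulD (fun j => x j ^ m) i f = 0 := hf
    change koszulD (fun j => x j ^ k) i (koszulPowMap x m k (i + 1) f) = 0
    rw [koszulPowMap_comm x h, hf', map_zero]

/-- The map `H_i(x₁ᵐ, …, xₙᵐ) → H_i(x₁ᵏ, …, xₙᵏ)` induced by `koszulPowMap`. -/
def koszulHomologyPowMap (x : Fin n → R) {m k : ℕ} (h : k ≤ m) (i : ℕ) :
    KoszulHomology (fun j => x j ^ m) i →ₗ[R] KoszulHomology (fun j => x j ^ k) i :=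
  Submodule.mapQ _ _
    ((koszulPowMap x m k i).restrict (koszulPowMap_mem_cycles x h i)) (by
      rintro ⟨f, hf⟩ ⟨g, hg⟩
      refine ⟨koszulPowMap x m k (i + 1) g, ?_⟩
      rw [koszulPowMap_comm x h, hg]
      rfl)

/-- A finite sequence is weakly proregular if for each `k` there is `m ≥ k` such that the maps
`H_i(x₁ᵐ, …, xₙᵐ) → H_i(x₁ᵏ, …, xₙᵏ)` are zero for all `i ≥ 1`. -/
def IsWeaklyProregular (x : Fin n → R) : Prop :=
  ∀ k : ℕ, ∃ m : ℕ, ∃ h : k ≤ m, ∀ i : ℕ, 1 ≤ i → koszulHomologyPowMap x h i = 0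

end Koszul

/-! ### Čech complex

The tensor product of the complexes `0 → R → R_{xⱼ} → 0`: in degree `i` it is the product of the
localizations `R_{∏_{j ∈ s} xⱼ}` over the `i`-element subsets `s` of the index set. -/

noncomputable section Cech

variable {R : Type*} [CommRing R] {n : ℕ}

/-- The localization of `R` at the product of the `xⱼ` with `j ∈ s`. -/
abbrev CechLoc (x : Fin n → R) (s : Finset (Fin n)) : Type _ :=
  Localization.Away (∏ j ∈ s, x j)

/-- The natural localization map `R_{x_s} → R_{x_t}` for `s ⊆ t`. -/
def cechRestrict (x : Fin n → R) {s t : Finset (Fin n)} (h : s ⊆ t) :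
    CechLoc x s →ₐ[R] CechLoc x t :=
  IsLocalization.liftAlgHom (M := Submonoid.powers (∏ j ∈ s, x j))
    (f := Algebra.ofId R (CechLoc x t)) (by
      rintro ⟨_, k, rfl⟩
      have h1 : IsUnit (algebraMap R (CechLoc x t) (∏ j ∈ t, x j)) :=
        IsLocalization.Away.algebraMap_isUnit _
      have h2 : IsUnit (algebraMap R (CechLoc x t) (∏ j ∈ s, x j)) :=
        isUnit_of_dvd_unit (map_dvd _ (Finset.prod_dvd_prod_of_subset s t x h)) h1
      simpa [Algebra.ofId_apply] using h2.pow k)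

/-- The module in degree `i` of the Čech complex `C(x)`. -/
abbrev CechModule (x : Fin n → R) (i : ℕ) : Type _ :=
  (s : {s : Finset (Fin n) // s.card = i}) → CechLoc x s.1

/-- The Čech differential `C^i(x) → C^{i+1}(x)`. -/
def cechD (x : Fin n → R) (i : ℕ) : CechModule x i →ₗ[R] CechModule x (i + 1) where
  toFun f t := ∑ j : {j : Fin n // j ∈ t.1},
    complexSign t.1 j.1 • cechRestrict x (Finset.erase_subset j.1 t.1)
      (f ⟨t.1.erase j.1, by rw [Finset.card_erase_of_mem j.2, t.2, Nat.add_sub_cancel]⟩)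
  map_add' f g := by
    funext t
    simp only [Pi.add_apply, map_add, smul_add, Finset.sum_add_distrib]
  map_smul' r f := by
    funext t
    simp only [Pi.smul_apply, map_smul, RingHom.id_apply, Finset.smul_sum]
    exact Finset.sum_congr rfl fun j _ => smul_comm _ _ _

theorem complexSign_erase_swap (t : Finset (Fin n)) {j k : Fin n} (hj : j ∈ t) (hk : k ∈ t) (h : j ≠ k) :
    complexSign t j * complexSign (t.erase j) k = -(complexSign t k * complexSign (t.erase k) j) := by
  obtain ⟨u, hju, hku, rfl⟩ : ∃ u, j ∉ u ∧ k ∉ u ∧ t = insert j (insert k u) :=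
    ⟨(t.erase j).erase k, by simp, by simp, by
      rw [Finset.insert_erase (by simp [hk, h.symm]), Finset.insert_erase hj]⟩
  rw [Finset.erase_insert (by simp [h, hju]), Finset.insert_comm, Finset.erase_insert (by simp [h.symm, hku])]
  unfold complexSign
  rcases lt_or_gt_of_ne h with h | h <;>
  · have h' := not_lt.mpr h.le
    simp only [Finset.filter_insert, h, h', lt_irrefl, if_true, if_false]
    simp [hju, hku, pow_succ]
    try ring

theorem cechRestrict_trans (x : Fin n → R) {s t u v : Finset (Fin n)}
    (h : s ⊆ t) (h' : t ⊆ u) (a : s ⊆ v) (b : v ⊆ u) (z) :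
    cechRestrict x h' (cechRestrict x h z) = cechRestrict x b (cechRestrict x a z) := by
  have : (cechRestrict x h').comp (cechRestrict x h) = (cechRestrict x b).comp (cechRestrict x a) :=
    IsLocalization.algHom_ext (Submonoid.powers (∏ j ∈ s, x j)) (by ext)
  exact congrArg (fun g => g z) this

theorem cechD_comp (x : Fin n → R) (i : ℕ) (f : CechModule x i) :
    cechD x (i+1) (cechD x i f) = 0 := by
  funext t
  simp only [cechD, LinearMap.coe_mk, AddHom.coe_mk, map_sum, Finset.smul_sum, Pi.zero_apply, map_zsmul, smul_smul]
  rw [Finset.sum_sigma']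
  refine Finset.sum_involution
    (fun a _ => ⟨⟨a.2.1, Finset.mem_of_mem_erase a.2.2⟩, ⟨a.1.1, 
      Finset.mem_erase.2 ⟨(Finset.ne_of_mem_erase a.2.2).symm, a.1.2⟩⟩⟩) ?_ ?_ ?_ ?_
  · rintro ⟨⟨j, hj⟩, ⟨k, hk⟩⟩ -
    have hks := Finset.mem_of_mem_erase hk
    have hjk : j ≠ k := (Finset.ne_of_mem_erase hk).symm
    have e := complexSign_erase_swap t.1 hj hks hjk
    simp only [e, neg_smul]
    rw [neg_add_eq_zero]
    congr 1
    have key : ∀ (w w' : Finset (Fin n)) (hw : w = w') (c : w.card = i) (c' : w'.card = i) (h1 : w ⊆ t.1.erase j) (h2 : w' ⊆ t.1.erase k),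
       cechRestrict x (Finset.erase_subset j t.1) (cechRestrict x h1 (f ⟨w, c⟩)) = cechRestrict x (Finset.erase_subset k t.1) (cechRestrict x h2 (f ⟨w', c'⟩)) := by
      rintro w w' rfl c c' h1 h2
      exact cechRestrict_trans _ _ _ _ _ _
    exact key _ _ Finset.erase_right_comm _ _ _ _
  · rintro ⟨⟨j, hj⟩, ⟨k, hk⟩⟩ - - h
    have : k = j := by simpa using congrArg (fun a => a.1.1) h
    exact Finset.ne_of_mem_erase hk this
  · intros; simp
  · rintro ⟨⟨j, hj⟩, ⟨k, hk⟩⟩ -; rfl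
/-- The cocycles of degree `i` of the Čech complex. -/
def cechCocycles (x : Fin n → R) (i : ℕ) : Submodule R (CechModule x i) :=
  LinearMap.ker (cechD x i)

/-- The coboundaries of degree `i` of the Čech complex. -/
def cechCoboundaries (x : Fin n → R) : (i : ℕ) → Submodule R (CechModule x i)
  | 0 => ⊥
  | i + 1 => LinearMap.range (cechD x i)

/-- The Čech cohomology `H^i_x(R)`. -/
abbrev CechCohomology (x : Fin n → R) (i : ℕ) : Type _ :=
  cechCocycles x i ⧸ (cechCoboundaries x i).submoduleOf (cechCocycles x i)

end Cech

/-! ### Cohen–Macaulay rings -/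

section CohenMacaulay

variable {R : Type*} [CommRing R]

/-- `x` is a parameter sequence on `R`: it is weakly proregular, it generates a proper ideal, and
`H^ℓ_x(R)_p ≠ 0` for all primes `p` containing it, where `ℓ` is its length. -/
structure IsParameterSequence (x : List R) : Prop where
  weaklyProregular : IsWeaklyProregular x.get
  ne_top : Ideal.ofList x ≠ ⊤
  cech_ne_zero : ∀ (p : Ideal R) [p.IsPrime], Ideal.ofList x ≤ p →
    Nontrivial (LocalizedModule p.primeCompl (CechCohomology x.get x.length))

/-- `x₁, …, x_ℓ` is a strong parameter sequence if `x₁, …, xᵢ` is a parameter sequence for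
`i = 1, …, ℓ`. -/
def IsStrongParameterSequence (x : List R) : Prop :=
  ∀ i : ℕ, 1 ≤ i → i ≤ x.length → IsParameterSequence (x.take i)

/-- A regular sequence on `R` (with `R ≠ (x)R`); by convention the empty sequence is regular on
every ring, including the zero ring. -/
def IsRegularSequence (x : List R) : Prop :=
  x = [] ∨ RingTheory.Sequence.IsRegular R x

variable (R) in
/-- A commutative ring, not necessarily Noetherian, is Cohen–Macaulay if every strong parameter
sequence on it is a regular sequence. -/
def IsCohenMacaulay : Prop :=
  ∀ x : List R, IsStrongParameterSequence x → IsRegularSequence x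

end CohenMacaulay

/-! ### The ring `ℂ + x ℂ⟦x, y⟧` -/

noncomputable section Example

/-- The subring `ℂ + x ℂ⟦x, y⟧` of `ℂ⟦x, y⟧`, where `x = X 0` and `y = X 1`. -/
def exampleRing : Subring (MvPowerSeries (Fin 2) ℂ) where
  carrier := {f | ∃ (c : ℂ) (g : MvPowerSeries (Fin 2) ℂ),
    f = MvPowerSeries.C c + MvPowerSeries.X 0 * g}
  zero_mem' := ⟨0, 0, by simp⟩
  one_mem' := ⟨1, 0, by simp⟩
  add_mem' := by
    rintro _ _ ⟨c, g, rfl⟩ ⟨d, h, rfl⟩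
    exact ⟨c + d, g + h, by rw [map_add]; ring⟩
  neg_mem' := by
    rintro _ ⟨c, g, rfl⟩
    exact ⟨-c, -g, by rw [map_neg]; ring⟩
  mul_mem' := by
    rintro _ _ ⟨c, g, rfl⟩ ⟨d, h, rfl⟩
    exact ⟨c * d, MvPowerSeries.C c * h + MvPowerSeries.C d * g + MvPowerSeries.X 0 * g * h, by
      rw [map_mul]; ring⟩

/-- The element `xy` of `ℂ + x ℂ⟦x, y⟧`. -/
def exampleXY : exampleRing :=
  ⟨MvPowerSeries.X 0 * MvPowerSeries.X 1, 0, MvPowerSeries.X 1, by simp⟩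

end Example

/-! ### Euclidean division for power series in two variables -/

section PowerSeriesEuclid

variable {k : Type*} [Field k]

/-! Write S = ℂ⟦x, y⟧. The nonunits of R form the ideal xS, and (xg)² = x · xg² shows that x divides
the square of each of them. Hence the maximal ideal is the only prime of R containing x. Away from x
nothing distinguishes R from S, since R[1/x] = S[1/x], and this is a principal ideal domain. So
below the maximal ideal chains of primes have length at most 1, which bounds the dimension by 2.

R is Cohen–Macaulay because parameter sequences of length 2 do not exist. The key is
`PowerSeries.exists_bezout`: after division by a common factor, two elements of S generate an ideal
containing a power of x. For nonunits a, b of R this puts (ab)^m in (a^(n+m), b^(n+m)) for some m,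
which kills H²_{a,b}(R) (`exampleRing_mul_pow_mem`). A parameter sequence of length 1 is a nonzero
element of a domain, hence regular.

In R/xyR the element x is a parameter: setting y = 0 maps it to a non-nilpotent nonunit of ℂ⟦x⟧, and
the kernel of this map is killed by x. But x · xy² = (xy)² while y ∉ R, so x kills the nonzero class
of xy² and is not regular. -/

theorem PowerSeries.C_X_dvd_of_map_constantCoeff_eq_zero {f : PowerSeries (PowerSeries k)}
    (hf : f.map PowerSeries.constantCoeff = 0) :
    PowerSeries.C (PowerSeries.X : PowerSeries k) ∣ f := by
  have h : ∀ i, (PowerSeries.X : PowerSeries k) ∣ f.coeff i := fun i => by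
    rw [PowerSeries.X_dvd_iff, ← PowerSeries.coeff_map, hf, map_zero]
  choose g hg using h
  refine ⟨PowerSeries.mk g, ?_⟩
  ext1 i
  rw [PowerSeries.coeff_C_mul, PowerSeries.coeff_mk, hg]

theorem PowerSeries.exists_eq_C_X_pow_mul {f : PowerSeries (PowerSeries k)} (hf : f ≠ 0) :
    ∃ (m : ℕ) (g : PowerSeries (PowerSeries k)),
      f = PowerSeries.C PowerSeries.X ^ m * g ∧ g.map PowerSeries.constantCoeff ≠ 0 := by
  have hu : ¬ IsUnit (PowerSeries.C (PowerSeries.X : PowerSeries k)) := fun h =>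
    PowerSeries.X_prime.not_isUnit (by simpa using h.map PowerSeries.constantCoeff)
  obtain ⟨g, hg, hg'⟩ :=
    (FiniteMultiplicity.of_not_isUnit hu hf).exists_eq_pow_mul_and_not_dvd
  exact ⟨_, g, hg, fun h => hg' (PowerSeries.C_X_dvd_of_map_constantCoeff_eq_zero h)⟩

/-- Division with remainder by a power series whose reduction modulo the first variable has
order `n`; the remainder is, up to a power of the first variable, zero or of smaller order. -/
theorem PowerSeries.exists_division {f : PowerSeries (PowerSeries k)}
    (hf : f.map PowerSeries.constantCoeff ≠ 0) (g : PowerSeries (PowerSeries k)) :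
    ∃ q r : PowerSeries (PowerSeries k), g = f * q + r ∧ (r = 0 ∨ ∃ (m : ℕ) (s : _),
      r = PowerSeries.C PowerSeries.X ^ m * s ∧ s.map PowerSeries.constantCoeff ≠ 0 ∧
      (s.map PowerSeries.constantCoeff).order.toNat <
        (f.map PowerSeries.constantCoeff).order.toNat) := by
  -- Weierstrass division needs a complete local coefficient ring, here k⟦x⟧.
  have : IsAdicComplete (IsLocalRing.maximalIdeal (PowerSeries k)) (PowerSeries k) := by
    rw [PowerSeries.maximalIdeal_eq_span_X]; infer_instance
  have hI : ∀ a : PowerSeries k, Ideal.Quotient.mk (IsLocalRing.maximalIdeal (PowerSeries k)) a = 0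
      ↔ PowerSeries.constantCoeff a = 0 := fun a => by
    rw [Ideal.Quotient.eq_zero_iff_mem, PowerSeries.maximalIdeal_eq_span_X,
      Ideal.mem_span_singleton, PowerSeries.X_dvd_iff]
  have hord : (f.map (Ideal.Quotient.mk (IsLocalRing.maximalIdeal (PowerSeries k)))).order =
      (f.map PowerSeries.constantCoeff).order := by
    refine le_antisymm (PowerSeries.le_order _ _ fun i hi => ?_)
      (PowerSeries.le_order _ _ fun i hi => ?_)
    · rw [PowerSeries.coeff_map, ← hI, ← PowerSeries.coeff_map]
      exact PowerSeries.coeff_of_lt_order _ hi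
    · rw [PowerSeries.coeff_map, hI, ← PowerSeries.coeff_map]
      exact PowerSeries.coeff_of_lt_order _ hi
  have hf' : f.map (IsLocalRing.residue (PowerSeries k)) ≠ 0 := fun h => hf <| by
    rw [← PowerSeries.order_eq_top] at h ⊢
    rw [← hord]
    exact h
  obtain ⟨q, r, h⟩ := PowerSeries.exists_isWeierstrassDivision g hf'
  refine ⟨q, r, h.eq_mul_add, ?_⟩
  by_cases hr : (r : PowerSeries (PowerSeries k)) = 0
  · exact Or.inl hr
  obtain ⟨m, s, hs, hs'⟩ := PowerSeries.exists_eq_C_X_pow_mul hr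
  refine Or.inr ⟨m, s, hs, hs', ?_⟩
  obtain ⟨i, hi⟩ := (PowerSeries.exists_coeff_ne_zero_iff_ne_zero).2 hs'
  -- The remainder is a polynomial in y of degree below the order of f modulo x. A nonzero
  -- coefficient of s modulo x at index i gives a nonzero coefficient of the remainder there, so i
  -- is below that order.
  have hdeg := h.degree_lt
  rw [hord] at hdeg
  have hlt : i < (f.map PowerSeries.constantCoeff).order.toNat := by
    by_contra! hle
    have h0 : (r : PowerSeries (PowerSeries k)).coeff i = 0 := by
      rw [Polynomial.coeff_coe]
      exact Polynomial.coeff_eq_zero_of_degree_lt (hdeg.trans_le (by exact_mod_cast hle))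
    rw [hs, ← map_pow, PowerSeries.coeff_C_mul] at h0
    rw [PowerSeries.coeff_map,
      (mul_eq_zero.1 h0).resolve_left (pow_ne_zero _ PowerSeries.X_ne_zero), map_zero] at hi
    exact hi rfl
  refine lt_of_le_of_lt ?_ hlt
  exact ENat.toNat_le_of_le_natCast (PowerSeries.order_le i hi)

/-- Euclid's algorithm, with the order in y of the reduction modulo x as the measure. Powers of x
are stripped from each remainder so that its reduction is nonzero; this is why the final identity
reaches only a power of x and not 1. -/
theorem PowerSeries.exists_bezout (f g : PowerSeries (PowerSeries k)) :
    ∃ (d F G α β : PowerSeries (PowerSeries k)) (j : ℕ), f = d * F ∧ g = d * G ∧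
      α * F + β * G = PowerSeries.C PowerSeries.X ^ j := by
  have key : ∀ (n : ℕ) (f g : PowerSeries (PowerSeries k)),
      f.map PowerSeries.constantCoeff ≠ 0 →
      (f.map PowerSeries.constantCoeff).order.toNat = n →
      ∃ (d F G α β : PowerSeries (PowerSeries k)) (j : ℕ), f = d * F ∧ g = d * G ∧
      α * F + β * G = PowerSeries.C PowerSeries.X ^ j := by
    intro n
    induction n using Nat.strong_induction_on with
    | _ n ih =>
      intro f g hf hn
      obtain ⟨q, r, hg, rfl | ⟨m, s, rfl, hs, hlt⟩⟩ := PowerSeries.exists_division hf g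
      · exact ⟨f, 1, q, 1, 0, 0, by simp, by simp [hg], by simp⟩
      -- The roles swap: s becomes the divisor and f the dividend, so F now belongs to s and G to f.
      · obtain ⟨d, F, G, α, β, j, h1, h2, h3⟩ := ih _ (hn ▸ hlt) s f hs rfl
        refine ⟨d, G, G * q + PowerSeries.C PowerSeries.X ^ m * F,
          PowerSeries.C PowerSeries.X ^ m * β - α * q, α, m + j, h2, ?_, ?_⟩
        · rw [hg, h1, h2]; ring
        · rw [pow_add, ← h3]; ring
  by_cases hf : f = 0
  · exact ⟨g, 0, 1, 0, 1, 0, by simp [hf], by simp, by simp⟩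
  obtain ⟨m, s, rfl, hs⟩ := PowerSeries.exists_eq_C_X_pow_mul hf
  obtain ⟨d, F, G, α, β, j, h1, h2, h3⟩ := key _ s g hs rfl
  refine ⟨d, PowerSeries.C PowerSeries.X ^ m * F, G, α, PowerSeries.C PowerSeries.X ^ m * β,
    m + j, ?_, h2, ?_⟩
  · rw [h1]; ring
  · rw [pow_add, ← h3]; ring

end PowerSeriesEuclid

/-! ### Power series in x and y, and their localization at x -/

noncomputable section TwoVariables

open MvPowerSeries

variable (k : Type*) [Field k]

/-- The isomorphism `k⟦x, y⟧ ≃ k⟦x⟧⟦y⟧`. -/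
def twoVarEquiv : MvPowerSeries (Fin 2) k ≃ₐ[k] PowerSeries (PowerSeries k) :=
  (renameEquiv k (show Fin 2 ≃ Option Unit from
    -- `none` becomes the outer variable, so y is outer and x lies in the coefficients.
    ⟨![some (), none], fun o => o.elim 1 fun _ => 0, by decide, by decide⟩)).trans
    (optionEquivLeft Unit k)

@[simp]
theorem twoVarEquiv_X_zero :
    twoVarEquiv k (X 0) = PowerSeries.C (PowerSeries.X : PowerSeries k) :=
  (congrArg (optionEquivLeft Unit k) (rename_X _ _)).trans (optionEquivLeft_X_some ())

@[simp]
theorem twoVarEquiv_X_one : twoVarEquiv k (X 1) = PowerSeries.X :=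
  (congrArg (optionEquivLeft Unit k) (rename_X _ _)).trans optionEquivLeft_X_none

@[simp]
theorem twoVarEquiv_C (c : k) : twoVarEquiv k (C c) = PowerSeries.C (PowerSeries.C c) :=
  (congrArg (optionEquivLeft Unit k) (rename_C _ _)).trans (optionEquivLeft_C c)

/-- The substitution `y = 0`. -/
def setYZero : MvPowerSeries (Fin 2) k →+* PowerSeries k :=
  PowerSeries.constantCoeff.comp (twoVarEquiv k : _ →+* _)

/-- The substitution `x = 0`. -/
def setXZero : MvPowerSeries (Fin 2) k →+* PowerSeries k :=
  (PowerSeries.map PowerSeries.constantCoeff).comp (twoVarEquiv k : _ →+* _)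

@[simp] theorem setYZero_X_zero : setYZero k (X 0) = PowerSeries.X := by simp [setYZero]

@[simp] theorem setYZero_X_one : setYZero k (X 1) = 0 := by simp [setYZero]

@[simp] theorem setXZero_X_zero : setXZero k (X 0) = 0 := by simp [setXZero]

@[simp] theorem setXZero_X_one : setXZero k (X 1) = PowerSeries.X := by simp [setXZero]

@[simp] theorem setXZero_C (c : k) : setXZero k (C c) = PowerSeries.C c := by simp [setXZero]

variable {k}

theorem X_zero_dvd_of_setXZero_eq_zero {f : MvPowerSeries (Fin 2) k} (h : setXZero k f = 0) :
    X 0 ∣ f := by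
  rw [← map_dvd_iff (twoVarEquiv k), twoVarEquiv_X_zero]
  exact PowerSeries.C_X_dvd_of_map_constantCoeff_eq_zero h

theorem X_one_dvd_of_setYZero_eq_zero {f : MvPowerSeries (Fin 2) k} (h : setYZero k f = 0) :
    X 1 ∣ f := by
  rw [← map_dvd_iff (twoVarEquiv k), twoVarEquiv_X_one]
  exact PowerSeries.X_dvd_iff.2 h

theorem MvPowerSeries.exists_bezout (f g : MvPowerSeries (Fin 2) k) :
    ∃ (d F G α β : MvPowerSeries (Fin 2) k) (j : ℕ), f = d * F ∧ g = d * G ∧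
      α * F + β * G = X 0 ^ j := by
  obtain ⟨d, F, G, α, β, j, h1, h2, h3⟩ :=
    PowerSeries.exists_bezout (twoVarEquiv k f) (twoVarEquiv k g)
  let e := (twoVarEquiv k).symm
  refine ⟨e d, e F, e G, e α, e β, j, ?_, ?_, ?_⟩
  · rw [← map_mul, ← h1, AlgEquiv.symm_apply_apply]
  · rw [← map_mul, ← h2, AlgEquiv.symm_apply_apply]
  · rw [← map_mul, ← map_mul, ← map_add, h3, ← twoVarEquiv_X_zero, ← map_pow,
      AlgEquiv.symm_apply_apply]

theorem X_zero_ne_zero : (X 0 : MvPowerSeries (Fin 2) k) ≠ 0 := fun h => by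
  simpa using congrArg (setYZero k) h

theorem X_one_ne_zero : (X 1 : MvPowerSeries (Fin 2) k) ≠ 0 := fun h => by
  simpa using congrArg (setXZero k) h

instance : IsDomain (MvPowerSeries (Fin 2) k) := NoZeroDivisors.to_isDomain _

variable (k) in
theorem isDomain_localization_X_zero (L : Type*) [CommRing L]
    [Algebra (MvPowerSeries (Fin 2) k) L]
    [IsLocalization.Away (X 0 : MvPowerSeries (Fin 2) k) L] : IsDomain L :=
  IsLocalization.isDomain_of_le_nonZeroDivisors (R := MvPowerSeries (Fin 2) k) L
    (powers_le_nonZeroDivisors_of_noZeroDivisors (M₀ := MvPowerSeries (Fin 2) k)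
      (x := X 0) X_zero_ne_zero)

variable (k) in
/-- Localized at `x`, the ring `k⟦x, y⟧` is a principal ideal ring. -/
theorem isPrincipalIdealRing_localization_X_zero (L : Type*) [CommRing L]
    [Algebra (MvPowerSeries (Fin 2) k) L]
    [IsLocalization.Away (X 0 : MvPowerSeries (Fin 2) k) L] : IsPrincipalIdealRing L := by
  set x : MvPowerSeries (Fin 2) k := X 0
  have hx : IsUnit (algebraMap (MvPowerSeries (Fin 2) k) L x) :=
    IsLocalization.Away.algebraMap_isUnit x
  have : IsNoetherianRing L := IsLocalization.isNoetherianRing (Submonoid.powers x) L inferInstance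
  have : IsDomain L := isDomain_localization_X_zero k L
  have : IsBezout L := by
    rw [IsBezout.iff_span_pair_isPrincipal]
    intro a b
    obtain ⟨⟨f, ⟨_, m, rfl⟩⟩, hf⟩ := IsLocalization.surj (Submonoid.powers x) a
    obtain ⟨⟨g, ⟨_, n, rfl⟩⟩, hg⟩ := IsLocalization.surj (Submonoid.powers x) b
    dsimp only at hf hg
    obtain ⟨d, F, G, α, β, j, h1, h2, h3⟩ := MvPowerSeries.exists_bezout f g
    have assoc : ∀ (c : L) (h : MvPowerSeries (Fin 2) k) (m : ℕ),
        c * algebraMap _ L (x ^ m) = algebraMap _ L h →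
        Associated c (algebraMap _ L h) := fun c h m e => by
      rw [← e, map_pow]
      exact associated_mul_unit_right _ _ (hx.pow m)
    have ha := assoc _ _ _ hf
    have hb := assoc _ _ _ hg
    refine ⟨⟨algebraMap _ L d, ?_⟩⟩
    change Ideal.span {a, b} = Ideal.span {algebraMap _ L d}
    rw [Ideal.span_insert, Ideal.span_singleton_eq_span_singleton.2 ha,
      Ideal.span_singleton_eq_span_singleton.2 hb, ← Ideal.span_insert]
    apply le_antisymm
    · rw [Ideal.span_le]
      rintro _ (rfl | rfl)
      · exact Ideal.mem_span_singleton.2 (map_dvd _ ⟨F, h1⟩)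
      · exact Ideal.mem_span_singleton.2 (map_dvd _ ⟨G, h2⟩)
    -- Since x is a unit of L, it suffices that x^j d = αf + βg lies in the ideal.
    · rw [Ideal.span_singleton_le_iff_mem, ← Ideal.unit_mul_mem_iff_mem _ (hx.pow j),
        ← map_pow, ← h3, ← map_mul, Ideal.mem_span_pair]
      refine ⟨algebraMap _ L α, algebraMap _ L β, ?_⟩
      rw [h1, h2]
      simp only [map_mul, map_add]
      ring
  infer_instance

end TwoVariables

/-! ### Čech cohomology and weak proregularity for special sequences -/

section CechKoszul

variable {R : Type*} [CommRing R]

theorem cechD_apply {n : ℕ} (x : Fin n → R) (i : ℕ) (f : CechModule x i)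
    (t : {s : Finset (Fin n) // s.card = i + 1}) :
    cechD x i f t = ∑ j : {j : Fin n // j ∈ t.1},
      complexSign t.1 j.1 • cechRestrict x (Finset.erase_subset j.1 t.1)
        (f ⟨t.1.erase j.1, by
          rw [Finset.card_erase_of_mem j.2, t.2, Nat.add_sub_cancel]⟩) := rfl

theorem koszulD_apply {n : ℕ} (x : Fin n → R) (i : ℕ) (f : KoszulModule R n (i + 1))
    (s : {s : Finset (Fin n) // s.card = i}) :
    koszulD x i f s = ∑ j : {j : Fin n // j ∉ s.1},
      complexSign s.1 j.1 • (x j.1 * f ⟨insert j.1 s.1, by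
        rw [Finset.card_insert_of_notMem j.2, s.2]⟩) := rfl

/-- The top Čech cohomology vanishes if for each `n` some power `(∏ xᵢ) ^ m` lies in the ideal
generated by the `xᵢ ^ (n + m)`. -/
theorem subsingleton_cechCohomology_of_prod_pow_mem {l : ℕ} (x : Fin (l + 1) → R)
    (h : ∀ n : ℕ, ∃ m : ℕ, (∏ j, x j) ^ m ∈ Ideal.span (Set.range fun j => x j ^ (n + m))) :
    Subsingleton (CechCohomology x (l + 1)) := by
  classical
  suffices hsurj : ∀ F : CechModule x (l + 1), F ∈ LinearMap.range (cechD x l) by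
    refine ⟨fun a b => ?_⟩
    obtain ⟨a, rfl⟩ := Submodule.Quotient.mk_surjective _ a
    obtain ⟨b, rfl⟩ := Submodule.Quotient.mk_surjective _ b
    exact (Submodule.Quotient.eq _).2 (hsurj (a - b : cechCocycles x (l + 1)))
  intro F
  let T : {s : Finset (Fin (l + 1)) // s.card = l + 1} := ⟨Finset.univ, by simp⟩
  have hT : ∀ t : {s : Finset (Fin (l + 1)) // s.card = l + 1}, t = T := fun t =>
    Subtype.ext (Finset.eq_univ_of_card _ (by simp [t.2]))
  obtain ⟨⟨r, ⟨_, n, rfl⟩⟩, hr⟩ :=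
    IsLocalization.surj (Submonoid.powers (∏ j ∈ T.1, x j)) (F T)
  dsimp only at hr
  -- Expand the fraction r/(∏ xᵢ)^n by (∏ xᵢ)^m = ∑ cⱼ xⱼ^(n+m). In the j-th summand xⱼ cancels from
  -- the denominator, so it comes from the localization that omits xⱼ.
  obtain ⟨m, hm⟩ := h n
  obtain ⟨c, hc⟩ := (Ideal.mem_span_range_iff_exists_fun).1 hm
  let e : (j : Fin (l + 1)) → {s : Finset (Fin (l + 1)) // s.card = l} := fun j =>
    ⟨Finset.univ.erase j, by simp⟩
  have he : Function.Injective e := fun i j hij => by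
    have h1 := congrArg Subtype.val hij
    by_contra hne
    have : i ∈ (e j).1 := Finset.mem_erase.2 ⟨hne, Finset.mem_univ i⟩
    rw [← hij] at this
    simp [e] at this
  have hsign : ∀ j, (complexSign T.1 j * complexSign T.1 j : ℤ) = 1 := fun j => by
    unfold complexSign
    rw [← mul_pow]
    simp
  -- the summand of the preimage at the complement of `j`
  let v : (j : Fin (l + 1)) → CechLoc x (e j).1 := fun j =>
    complexSign T.1 j • IsLocalization.mk' (M := Submonoid.powers (∏ i ∈ (e j).1, x i)) _
      (c j * r) ⟨(∏ i ∈ (e j).1, x i) ^ (n + m), n + m, rfl⟩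
  refine ⟨∑ j, Pi.single (e j) (v j), ?_⟩
  funext t
  obtain rfl := hT t
  have hG : ∀ j, (∑ j, Pi.single (e j) (v j) : CechModule x l) (e j) = v j := fun j => by
    rw [Finset.sum_apply, Finset.sum_eq_single j]
    · rw [Pi.single_eq_same]
    · intro i _ hij
      rw [Pi.single_eq_of_ne (fun h => hij (he h).symm)]
    · simp
  have hu : IsUnit (algebraMap R (CechLoc x T.1) (∏ j ∈ T.1, x j)) :=
    IsLocalization.Away.algebraMap_isUnit _
  have hterm : ∀ j : Fin (l + 1), complexSign T.1 j • cechRestrict x (Finset.erase_subset j T.1) (v j) *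
      algebraMap R (CechLoc x T.1) ((∏ j ∈ T.1, x j) ^ (n + m)) =
      algebraMap R _ (c j * r * x j ^ (n + m)) := fun j => by
    have h1 : (∏ j ∈ T.1, x j) ^ (n + m) = (∏ i ∈ (e j).1, x i) ^ (n + m) * x j ^ (n + m) := by
      rw [← mul_pow, mul_comm]
      exact congrArg (· ^ (n + m)) (Finset.mul_prod_erase _ _ (Finset.mem_univ j)).symm
    have h2 : IsLocalization.mk' (M := Submonoid.powers (∏ i ∈ (e j).1, x i)) (CechLoc x (e j).1)
      (c j * r) ⟨(∏ i ∈ (e j).1, x i) ^ (n + m), n + m, rfl⟩ *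
      algebraMap R (CechLoc x (e j).1) ((∏ i ∈ (e j).1, x i) ^ (n + m)) =
      algebraMap R _ (c j * r) := 
      IsLocalization.mk'_spec (M := Submonoid.powers (∏ i ∈ (e j).1, x i)) (CechLoc x (e j).1)
        (c j * r) ⟨(∏ i ∈ (e j).1, x i) ^ (n + m), n + m, rfl⟩
    have h3 := congrArg (cechRestrict x (Finset.erase_subset j T.1)) h2
    rw [map_mul, AlgHom.commutes, AlgHom.commutes] at h3
    rw [map_zsmul, smul_smul, hsign, one_smul, h1, map_mul, ← mul_assoc, map_mul _ (c j * r), ← h3]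
  have hmul : cechD x l (∑ j, Pi.single (e j) (v j)) T *
      algebraMap R (CechLoc x T.1) ((∏ j ∈ T.1, x j) ^ (n + m)) =
      F T * algebraMap R (CechLoc x T.1) ((∏ j ∈ T.1, x j) ^ (n + m)) := by
    have h4 : cechD x l (∑ j, Pi.single (e j) (v j)) T = ∑ j : Fin (l + 1),
        complexSign T.1 j • cechRestrict x (Finset.erase_subset j T.1) (v j) := by
      rw [cechD_apply]
      refine (Fintype.sum_equiv (Equiv.subtypeUnivEquiv fun j => Finset.mem_univ j) _ _
        fun j => ?_)
      exact congrArg (fun z => complexSign T.1 j.1 •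
        cechRestrict x (Finset.erase_subset j.1 T.1) z) (hG j.1)
    rw [h4, Finset.sum_mul, Finset.sum_congr rfl fun j _ => hterm j, ← map_sum, pow_add, map_mul,
      ← mul_assoc, hr, ← map_mul]
    have h5 : (∏ j ∈ T.1, x j) ^ m = ∑ i, c i * x i ^ (n + m) := hc.symm
    rw [h5, Finset.mul_sum]
    refine congrArg _ (Finset.sum_congr rfl fun j _ => by ring)
  rw [map_pow] at hmul
  exact (hu.pow _).mul_right_cancel hmul

/-- If the first Čech cohomology of a single element `z` vanishes, then
`z ^ m ∈ (z ^ (m + 1))` for some `m`. -/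
theorem exists_pow_eq_of_subsingleton_cechCohomology (x : Fin 1 → R)
    (h : Subsingleton (CechCohomology x 1)) : ∃ (m : ℕ) (a : R), x 0 ^ m = x 0 ^ (m + 1) * a := by
  -- The class of 1/z: if it is a coboundary, then 1/z = a/1 for some a in R.
  let F : CechModule x 1 := fun s => IsLocalization.Away.invSelf (∏ j ∈ s.1, x j)
  have hF : F ∈ cechCocycles x 1 := by
    refine LinearMap.mem_ker.2 (funext fun s => ?_)
    have h1 := s.2
    have h2 := Finset.card_le_univ s.1
    simp at h2
    omega
  have hF' : F ∈ LinearMap.range (cechD x 0) := by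
    have h1 := (Submodule.Quotient.mk_eq_zero
      ((cechCoboundaries x 1).submoduleOf (cechCocycles x 1)) (x := ⟨F, hF⟩)).1
      (Subsingleton.elim _ _)
    exact h1
  obtain ⟨G, hG⟩ := hF'
  let T : {s : Finset (Fin 1) // s.card = 1} := ⟨Finset.univ, by simp⟩
  have hGT := congrFun hG T
  have hprod : ∏ j ∈ T.1, x j = x 0 := by simp [T]
  have hconst : ∀ s : {s : Finset (Fin 1) // s.card = 0}, ∃ a : R, G s = algebraMap R _ a := by
    rintro ⟨s, hs⟩
    obtain rfl := Finset.card_eq_zero.1 hs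
    obtain ⟨⟨r, ⟨_, n, rfl⟩⟩, hr⟩ :=
      IsLocalization.surj (Submonoid.powers (∏ j ∈ (∅ : Finset (Fin 1)), x j)) (G ⟨∅, hs⟩)
    refine ⟨r, ?_⟩
    simpa using hr
  have hterm : ∀ j : {j : Fin 1 // j ∈ T.1}, ∃ a : R, complexSign T.1 j.1 •
      cechRestrict x (Finset.erase_subset j.1 T.1) (G ⟨T.1.erase j.1, by
        rw [Finset.card_erase_of_mem j.2, T.2]⟩) = algebraMap R (CechLoc x T.1) a := fun j => by
    obtain ⟨a, ha⟩ := hconst ⟨T.1.erase j.1, by rw [Finset.card_erase_of_mem j.2, T.2]⟩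
    refine ⟨complexSign T.1 j.1 • a, ?_⟩
    rw [ha, AlgHom.commutes, map_zsmul]
  choose a ha using hterm
  have hsum : F T = algebraMap R (CechLoc x T.1) (∑ j, a j) := by
    rw [← hGT, map_sum, cechD_apply]
    exact Finset.sum_congr rfl fun j _ => ha j
  have hone : algebraMap R (CechLoc x T.1) (x 0 * ∑ j, a j) = algebraMap R (CechLoc x T.1) 1 := by
    rw [map_mul, ← hsum, map_one, ← hprod]
    exact IsLocalization.Away.mul_invSelf _
  obtain ⟨⟨_, m, rfl⟩, hm⟩ :=
    (IsLocalization.eq_iff_exists (Submonoid.powers (∏ j ∈ T.1, x j)) _).1 hone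
  refine ⟨m, ∑ j, a j, ?_⟩
  simp only [hprod, mul_one] at hm
  rw [← hm]
  ring

/-- A single element `z` with `0 : zⁿ ⊆ 0 : z` for all `n` is weakly proregular. -/
theorem isWeaklyProregular_of_pow_mul_eq_zero (x : Fin 1 → R)
    (h : ∀ (n : ℕ) (a : R), x 0 ^ n * a = 0 → x 0 * a = 0) : IsWeaklyProregular x := by
  intro k
  -- In degree 1 the transition map from exponent k + 1 to k is multiplication by z, which kills
  -- every a with z^(k+1) a = 0.
  refine ⟨k + 1, Nat.le_succ k, fun i hi => ?_⟩
  obtain ⟨i, rfl⟩ : ∃ i', i = i' + 1 := ⟨i - 1, by omega⟩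
  refine LinearMap.ext fun a => ?_
  obtain ⟨⟨f, hf⟩, rfl⟩ := Submodule.Quotient.mk_surjective _ a
  suffices h0 : koszulPowMap x (k + 1) k (i + 1) f = 0 by
    refine (Submodule.Quotient.mk_eq_zero _).2 ?_
    refine Submodule.mem_comap.2 ?_
    convert! zero_mem (koszulBoundaries (fun j => x j ^ k) (i + 1))
  funext s
  have hs : s.1 = {0} := by
    have h1 := s.2
    have h2 := Finset.card_pos.1 (by omega : 0 < s.1.card)
    exact Finset.eq_singleton_iff_nonempty_unique_mem.2 ⟨h2, fun j _ => Subsingleton.elim _ _⟩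
  obtain rfl : i = 0 := by have := s.2; rw [hs] at this; simpa using this.symm
  obtain ⟨_, hc⟩ := s
  obtain rfl : _ = ({0} : Finset (Fin 1)) := hs
  have hcyc := congrFun (LinearMap.mem_ker.1 hf) ⟨∅, rfl⟩
  have h1 : x 0 ^ (k + 1) * f ⟨{0}, hc⟩ = 0 := by
    rw [koszulD_apply, Fintype.sum_eq_single ⟨0, Finset.notMem_empty 0⟩
      fun j hj => (hj (Subsingleton.elim _ _)).elim] at hcyc
    simpa [complexSign] using hcyc
  simpa [koszulPowMap] using h _ _ h1

theorem LocalizedModule.nontrivial_of_isUnit {M : Type*} [AddCommGroup M] [Module R M]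
    [Nontrivial M] (S : Submonoid R) (hS : ∀ s ∈ S, IsUnit s) :
    Nontrivial (LocalizedModule S M) := by
  obtain ⟨v, hv⟩ := exists_ne (0 : M)
  refine ⟨LocalizedModule.mk v 1, LocalizedModule.mk 0 1, fun h => hv ?_⟩
  obtain ⟨u, hu⟩ := LocalizedModule.mk_eq.1 h
  simp only [one_smul, smul_zero] at hu
  exact (hS _ u.2).smul_eq_zero.1 hu

end CechKoszul

/-! ### The ring `ℂ + x ℂ⟦x, y⟧` -/

noncomputable section ExampleProperties

open MvPowerSeries

theorem X_zero_mul_mem_exampleRing (g : MvPowerSeries (Fin 2) ℂ) : X 0 * g ∈ exampleRing :=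
  ⟨0, g, by simp⟩

/-- The element `x g` of `ℂ + x ℂ⟦x, y⟧`. -/
def exampleXMul (g : MvPowerSeries (Fin 2) ℂ) : exampleRing :=
  ⟨X 0 * g, X_zero_mul_mem_exampleRing g⟩

@[simp]
theorem coe_exampleXMul (g : MvPowerSeries (Fin 2) ℂ) :
    (exampleXMul g : MvPowerSeries (Fin 2) ℂ) = X 0 * g := rfl

/-- The constant coefficient on `ℂ + x ℂ⟦x, y⟧`. -/
def exampleConst : exampleRing →+* ℂ :=
  (constantCoeff (σ := Fin 2) (R := ℂ)).comp exampleRing.subtype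

@[simp]
theorem exampleConst_exampleXMul (g : MvPowerSeries (Fin 2) ℂ) :
    exampleConst (exampleXMul g) = 0 := by
  simp [exampleConst]

theorem exists_eq_exampleXMul {r : exampleRing} (h : exampleConst r = 0) :
    ∃ g, r = exampleXMul g := by
  obtain ⟨_, c, g, rfl⟩ := r
  have hc : c = 0 := by simpa [exampleConst] using h
  exact ⟨g, Subtype.ext (by simp [hc])⟩

theorem isUnit_of_exampleConst_ne_zero {r : exampleRing} (h : exampleConst r ≠ 0) :
    IsUnit r := by
  obtain ⟨_, c, g, rfl⟩ := r
  have hc : c ≠ 0 := by simpa [exampleConst] using h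
  obtain ⟨s, hs⟩ : ∃ s, (C c + X 0 * g) * s = 1 :=
    (isUnit_iff_constantCoeff.2 (by simpa using hc)).exists_right_inv
  have hcc : (C c * C c⁻¹ : MvPowerSeries (Fin 2) ℂ) = 1 := by
    rw [← map_mul, mul_inv_cancel₀ hc, map_one]
  -- The inverse taken in S lies in R: (c + xg)s = 1 gives s = c⁻¹ - x c⁻¹ g s.
  refine IsUnit.of_mul_eq_one ⟨s, c⁻¹, -(C c⁻¹ * g * s), ?_⟩ (Subtype.ext hs)
  linear_combination C c⁻¹ * hs - s * hcc

instance : IsLocalHom exampleConst :=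
  ⟨fun _ h => isUnit_of_exampleConst_ne_zero h.ne_zero⟩

instance : IsLocalRing exampleRing := exampleConst.domain_isLocalRing

theorem exists_eq_exampleXMul_of_not_isUnit {r : exampleRing} (h : ¬ IsUnit r) :
    ∃ g, r = exampleXMul g :=
  exists_eq_exampleXMul (by by_contra h'; exact h (isUnit_of_exampleConst_ne_zero h'))

theorem exampleXMul_one_dvd_sq (g : MvPowerSeries (Fin 2) ℂ) :
    exampleXMul 1 ∣ exampleXMul g ^ 2 :=
  ⟨exampleXMul (g ^ 2), Subtype.ext (by simp; ring)⟩

/-- A prime ideal containing `x` contains all nonunits. -/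
theorem exampleRing_mem_prime_of_not_isUnit {p : Ideal exampleRing} [p.IsPrime]
    (hp : exampleXMul 1 ∈ p) {r : exampleRing} (hr : ¬ IsUnit r) : r ∈ p := by
  obtain ⟨g, rfl⟩ := exists_eq_exampleXMul_of_not_isUnit hr
  exact ‹p.IsPrime›.mem_of_pow_mem 2 (Ideal.mem_of_dvd p (exampleXMul_one_dvd_sq g) hp)

theorem exampleXMul_one_ne_zero : exampleXMul 1 ≠ 0 := fun h => by
  have h1 := congrArg (fun r : exampleRing => setYZero ℂ r) h
  simp at h1

theorem exists_setXZero_eq_C (r : exampleRing) : ∃ c, setXZero ℂ r = PowerSeries.C c := by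
  obtain ⟨_, c, g, rfl⟩ := r
  exact ⟨c, by simp⟩

/-! ### Dimension -/

/-- Inverting `x` in `ℂ + x ℂ⟦x, y⟧` gives `ℂ⟦x, y⟧[1/x]`. -/
theorem isLocalization_exampleRing (L : Type*) [CommRing L]
    [Algebra (MvPowerSeries (Fin 2) ℂ) L] [Algebra exampleRing L]
    [IsScalarTower exampleRing (MvPowerSeries (Fin 2) ℂ) L]
    [IsLocalization.Away (X 0 : MvPowerSeries (Fin 2) ℂ) L] :
    IsLocalization.Away (exampleXMul 1) L := by
  have hinj : Function.Injective (algebraMap (MvPowerSeries (Fin 2) ℂ) L) :=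
    IsLocalization.injective L (powers_le_nonZeroDivisors_of_noZeroDivisors
      (x := (X 0 : MvPowerSeries (Fin 2) ℂ)) X_zero_ne_zero)
  have hmap : ∀ r : exampleRing, algebraMap exampleRing L r =
      algebraMap (MvPowerSeries (Fin 2) ℂ) L r := fun r =>
    IsScalarTower.algebraMap_apply exampleRing (MvPowerSeries (Fin 2) ℂ) L r
  have hx : IsUnit (algebraMap (MvPowerSeries (Fin 2) ℂ) L (X 0)) :=
    IsLocalization.Away.algebraMap_isUnit _
  refine ⟨?_, fun z => ?_, fun {a b} h => ⟨1, ?_⟩⟩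
  · rintro ⟨_, n, rfl⟩
    simpa [hmap] using hx.pow n
  · obtain ⟨⟨f, ⟨_, n, rfl⟩⟩, hf⟩ := IsLocalization.surj
      (Submonoid.powers (X 0 : MvPowerSeries (Fin 2) ℂ)) z
    -- The numerator f need not lie in R but xf does, hence the fraction xf/x^(n+1).
    refine ⟨⟨exampleXMul f, ⟨_, n + 1, rfl⟩⟩, ?_⟩
    simp only [hmap, coe_exampleXMul, map_mul, ← hf, SubmonoidClass.coe_pow, mul_one, map_pow]
    ring
  · rw [hmap, hmap] at h
    rw [Subtype.ext (hinj h)]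

/-- Nonzero primes not containing `x` are maximal among the primes not containing `x`. -/
theorem exampleRing_not_lt_of_exampleXMul_one_notMem {p q : Ideal exampleRing} [p.IsPrime]
    [q.IsPrime] (hp : p ≠ ⊥) (hq : exampleXMul 1 ∉ q) : ¬ p < q := by
  intro hpq
  let L := Localization.Away (X 0 : MvPowerSeries (Fin 2) ℂ)
  have : IsDomain L := isDomain_localization_X_zero ℂ L
  have : IsPrincipalIdealRing L := isPrincipalIdealRing_localization_X_zero ℂ L
  have : IsLocalization.Away (exampleXMul 1) L := isLocalization_exampleRing L
  have hdq : Disjoint (Submonoid.powers (exampleXMul 1) : Set exampleRing) q :=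
    (Ideal.disjoint_powers_iff_notMem _ (Ideal.IsPrime.isRadical ‹_›)).2 hq
  have hdp : Disjoint (Submonoid.powers (exampleXMul 1) : Set exampleRing) p :=
    hdq.mono_right hpq.le
  have hcp := IsLocalization.under_map_of_isPrime_disjoint
    (Submonoid.powers (exampleXMul 1)) L ‹p.IsPrime› hdp
  have hcq := IsLocalization.under_map_of_isPrime_disjoint
    (Submonoid.powers (exampleXMul 1)) L ‹q.IsPrime› hdq
  have hPp := IsLocalization.isPrime_of_isPrime_disjoint
    (Submonoid.powers (exampleXMul 1)) L p ‹_› hdp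
  have hPq := IsLocalization.isPrime_of_isPrime_disjoint
    (Submonoid.powers (exampleXMul 1)) L q ‹_› hdq
  have hne : p.map (algebraMap exampleRing L) ≠ ⊥ := fun h => by
    rw [h] at hcp
    refine hp (eq_bot_iff.2 fun r hr => ?_)
    rw [← hcp, Ideal.mem_comap, Ideal.mem_bot] at hr
    exact IsLocalization.injective L (powers_le_nonZeroDivisors_of_noZeroDivisors
      exampleXMul_one_ne_zero) (hr.trans (map_zero _).symm)
  -- Nonzero primes of a principal ideal domain are maximal, so the extensions of p and q to L
  -- coincide.
  have hmax := hPp.isMaximal hne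
  have heq := hmax.eq_of_le hPq.ne_top (Ideal.map_mono hpq.le)
  rw [heq, hcq] at hcp
  exact hpq.ne hcp.symm

theorem ringKrullDim_exampleRing_le : ringKrullDim exampleRing ≤ 2 := by
  refine iSup_le fun s => ?_
  by_contra! h
  have hlen : 3 ≤ s.length := by
    have : (2 : ℕ) < s.length := by exact_mod_cast h
    omega
  have h01 : s ⟨0, by omega⟩ < s ⟨1, by omega⟩ := s.strictMono (by simp [Fin.lt_def])
  have h12 : s ⟨1, by omega⟩ < s ⟨2, by omega⟩ := s.strictMono (by simp [Fin.lt_def])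
  have h23 : s ⟨2, by omega⟩ < s ⟨3, by omega⟩ := s.strictMono (by simp [Fin.lt_def])
  -- In a chain s₀ < s₁ < s₂ < s₃ the prime s₁ is nonzero, so s₂ would have to contain x; then s₂
  -- contains all nonunits and nothing proper lies above it.
  refine exampleRing_not_lt_of_exampleXMul_one_notMem
    (p := (s ⟨1, by omega⟩).asIdeal) (q := (s ⟨2, by omega⟩).asIdeal) ?_ ?_ h12
  · exact (bot_le.trans_lt
      (show (s ⟨0, by omega⟩).asIdeal < (s ⟨1, by omega⟩).asIdeal from h01)).ne'
  · intro hx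
    refine (not_le_of_gt h23) fun r hr => ?_
    exact exampleRing_mem_prime_of_not_isUnit hx
      fun hu => (s ⟨3, by omega⟩).2.ne_top (Ideal.eq_top_of_isUnit_mem _ hr hu)

/-- The chain is 0 < (kernel of y = 0) < maximal ideal; xy witnesses the first strict inclusion and
x the second. -/
theorem two_le_ringKrullDim_exampleRing : 2 ≤ ringKrullDim exampleRing := by
  let φ : exampleRing →+* PowerSeries ℂ := (setYZero ℂ).comp exampleRing.subtype
  let p : PrimeSpectrum exampleRing := ⟨RingHom.ker φ, RingHom.ker_isPrime φ⟩
  let m : PrimeSpectrum exampleRing := ⟨RingHom.ker exampleConst, RingHom.ker_isPrime _⟩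
  have h1 : (⊥ : PrimeSpectrum exampleRing) < p := by
    refine bot_lt_iff_ne_bot.2 fun h => ?_
    have h2 : exampleXMul (X 1) ∈ p.asIdeal := by simp [p, φ, RingHom.mem_ker]
    rw [h] at h2
    have h3 := congrArg (fun r : exampleRing => (r : MvPowerSeries (Fin 2) ℂ)) (Ideal.mem_bot.1 h2)
    exact mul_ne_zero X_zero_ne_zero X_one_ne_zero h3
  have h2 : p < m := by
    refine lt_of_le_of_ne (fun r hr => ?_) fun h => ?_
    · refine RingHom.mem_ker.2 ?_
      by_contra h
      exact p.2.ne_top (Ideal.eq_top_of_isUnit_mem _ hr (isUnit_of_exampleConst_ne_zero h))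
    · have h3 : exampleXMul 1 ∈ m.asIdeal := exampleConst_exampleXMul 1
      rw [← h] at h3
      have h4 : φ (exampleXMul 1) = 0 := h3
      simp [φ] at h4
  let s : LTSeries (PrimeSpectrum exampleRing) :=
    ((RelSeries.singleton _ ⊥).snoc p h1).snoc m
      ((RelSeries.last_snoc (RelSeries.singleton {ab : _ × _ | ab.1 < ab.2} ⊥) p h1).symm ▸ h2)
  have hs : s.length = 2 := rfl
  exact le_iSup_of_le s (by rw [hs]; rfl)

theorem ringKrullDim_exampleRing : ringKrullDim exampleRing = 2 :=
  le_antisymm ringKrullDim_exampleRing_le two_le_ringKrullDim_exampleRing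

/-! ### Cohen–Macaulayness -/

/-- With a = xf and b = xg, write fⁿ = dF, gⁿ = dG and αF + βG = x^j. Then fⁿG = gⁿF turns both
terms of the combination into multiples of (fg)^m, and their sum contributes the factor x^j. -/
theorem exampleRing_mul_pow_mem (a b : exampleRing) (ha : ¬ IsUnit a) (hb : ¬ IsUnit b) (n : ℕ) :
    ∃ m : ℕ, (a * b) ^ m ∈ Ideal.span {a ^ (n + m), b ^ (n + m)} := by
  obtain ⟨f, rfl⟩ := exists_eq_exampleXMul_of_not_isUnit ha
  obtain ⟨g, rfl⟩ := exists_eq_exampleXMul_of_not_isUnit hb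
  obtain ⟨d, F, G, α, β, j, h1, h2, h3⟩ := MvPowerSeries.exists_bezout (f ^ n) (g ^ n)
  have h4 : f ^ n * G = g ^ n * F := by rw [h1, h2]; ring
  -- The coefficients carry an extra factor x in order to lie in R. Comparing exponents of x, 1 + (n
  -- + m) + j = 2m, which forces m = n + j + 1.
  refine ⟨n + j + 1, Ideal.mem_span_pair.2
    ⟨exampleXMul (α * g ^ (j + 1) * G), exampleXMul (β * f ^ (j + 1) * F), Subtype.ext ?_⟩⟩
  simp only [Subring.coe_add, Subring.coe_mul, SubmonoidClass.coe_pow, coe_exampleXMul]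
  linear_combination (X 0 ^ (2 * n + j + 2) * α * g ^ (j + 1) * f ^ (n + j + 1) -
      X 0 ^ (2 * n + j + 2) * β * f ^ (j + 1) * g ^ (n + j + 1)) * h4 +
    X 0 ^ (2 * n + j + 2) * f ^ (n + j + 1) * g ^ (n + j + 1) * h3

theorem exampleRing_not_isParameterSequence_pair (a b : exampleRing) :
    ¬ IsParameterSequence [a, b] := by
  intro h
  have hu : ∀ c ∈ [a, b], ¬ IsUnit c := fun c hc hu =>
    h.ne_top (Ideal.eq_top_of_isUnit_mem _ (Ideal.subset_span hc) hu)
  have : Subsingleton (CechCohomology [a, b].get 2) := by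
    refine subsingleton_cechCohomology_of_prod_pow_mem (l := 1) [a, b].get fun n => ?_
    obtain ⟨m, hm⟩ := exampleRing_mul_pow_mem a b (hu a (by simp)) (hu b (by simp)) n
    refine ⟨m, ?_⟩
    have h1 : ∏ j, [a, b].get j = a * b := Fin.prod_univ_two _
    have h2 : (Set.range fun j => [a, b].get j ^ (n + m)) = {a ^ (n + m), b ^ (n + m)} := by
      ext c
      simp only [Set.mem_range, Set.mem_insert_iff, Set.mem_singleton_iff]
      refine (Fin.exists_fin_two (p := fun j => [a, b].get j ^ (n + m) = c)).trans ?_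
      simp [eq_comm]
    exact (congrArg₂ (fun c s => c ^ m ∈ Ideal.span s) h1 h2).mpr hm
  obtain ⟨p, hp, hle⟩ := Ideal.exists_le_maximal _ h.ne_top
  have := hp.isPrime
  have h3 := h.cech_ne_zero p hle
  exact not_subsingleton _ (inferInstance :
    Subsingleton (LocalizedModule p.primeCompl (CechCohomology [a, b].get 2)))

theorem not_isParameterSequence_zero {R : Type*} [CommRing R] : ¬ IsParameterSequence [(0 : R)] := by
  intro h
  have : Subsingleton (CechCohomology [(0 : R)].get 1) := by
    -- The exponent is 1 and not 0, because 0⁰ = 1.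
    refine subsingleton_cechCohomology_of_prod_pow_mem (l := 0) [(0 : R)].get fun n => ⟨1, ?_⟩
    have h1 : (∏ j, [(0 : R)].get j) ^ 1 = 0 := (pow_one _).trans (Fin.prod_univ_one _)
    exact (congrArg (· ∈ Ideal.span _) h1).mpr (zero_mem _)
  obtain ⟨p, hp, hle⟩ := Ideal.exists_le_maximal _ h.ne_top
  have := hp.isPrime
  have h3 := h.cech_ne_zero p hle
  exact not_subsingleton _ (inferInstance :
    Subsingleton (LocalizedModule p.primeCompl (CechCohomology [(0 : R)].get 1)))

theorem isCohenMacaulay_exampleRing : IsCohenMacaulay exampleRing := by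
  rintro (_ | ⟨a, _ | ⟨b, l⟩⟩) hx
  · exact Or.inl rfl
  · have h1 : IsParameterSequence [a] := hx 1 le_rfl (by simp)
    have ha : a ≠ 0 := by rintro rfl; exact not_isParameterSequence_zero h1
    refine Or.inr ⟨?_, ?_⟩
    · rw [RingTheory.Sequence.isWeaklyRegular_singleton_iff]
      exact fun b c h => mul_left_cancel₀ ha h
    · intro h
      exact h1.ne_top (by simpa using h.symm)
  · exact (exampleRing_not_isParameterSequence_pair a b (hx 2 (by simp) (by simp))).elim

/-! ### The quotient by `xy` -/

theorem exampleXY_eq : exampleXY = exampleXMul (X 1) := rfl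

theorem exampleXY_ne_zero : exampleXY ≠ 0 := fun h => by
  exact mul_ne_zero X_zero_ne_zero X_one_ne_zero (congrArg Subtype.val h)

/-- The image of `x` in the quotient of `ℂ + x ℂ⟦x, y⟧` by `xy`. -/
def exampleQuotX : exampleRing ⧸ Ideal.span {exampleXY} := Ideal.Quotient.mk _ (exampleXMul 1)

/-- Setting `y = 0` in the quotient of `ℂ + x ℂ⟦x, y⟧` by `xy`. -/
def exampleQuotSetYZero : exampleRing ⧸ Ideal.span {exampleXY} →+* PowerSeries ℂ :=
  Ideal.Quotient.lift _ ((setYZero ℂ).comp exampleRing.subtype) fun r hr => by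
    obtain ⟨s, rfl⟩ := Ideal.mem_span_singleton.1 hr
    simp [exampleXY_eq]

@[simp]
theorem exampleQuotSetYZero_exampleQuotX : exampleQuotSetYZero exampleQuotX = PowerSeries.X := by
  simp [exampleQuotSetYZero, exampleQuotX]

/-- A class killed by xⁿ vanishes at y = 0, so its representative is r = yg. At x = 0 an element of
R is constant, so g vanishes there and r = xyt. Then xr = xy · xt with xt in R, even if t is not. -/
theorem exampleQuotX_pow_mul_eq_zero (n : ℕ) (a : exampleRing ⧸ Ideal.span {exampleXY})
    (h : exampleQuotX ^ n * a = 0) : exampleQuotX * a = 0 := by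
  obtain ⟨r, rfl⟩ := Ideal.Quotient.mk_surjective a
  have h1 := congrArg exampleQuotSetYZero h
  rw [map_mul, map_pow, exampleQuotSetYZero_exampleQuotX, map_zero] at h1
  have h2 : setYZero ℂ r = 0 :=
    (mul_eq_zero.1 h1).resolve_left (pow_ne_zero _ PowerSeries.X_ne_zero)
  obtain ⟨g, hg⟩ := X_one_dvd_of_setYZero_eq_zero h2
  obtain ⟨c, hc⟩ := exists_setXZero_eq_C r
  rw [hg, map_mul, setXZero_X_one] at hc
  have hc0 : c = 0 := by simpa using (congrArg PowerSeries.constantCoeff hc).symm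
  rw [hc0, map_zero] at hc
  obtain ⟨t, rfl⟩ := X_zero_dvd_of_setXZero_eq_zero
    ((mul_eq_zero.1 hc).resolve_left PowerSeries.X_ne_zero)
  rw [exampleQuotX, ← map_mul, Ideal.Quotient.eq_zero_iff_mem, Ideal.mem_span_singleton]
  refine ⟨exampleXMul t, Subtype.ext ?_⟩
  simp only [exampleXY_eq, Subring.coe_mul, coe_exampleXMul, hg]
  ring

theorem exampleQuotX_not_isUnit : ¬ IsUnit exampleQuotX := fun h =>
  PowerSeries.X_prime.not_isUnit (by simpa using h.map exampleQuotSetYZero)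

theorem exampleQuotX_not_isSMulRegular :
    ¬ IsSMulRegular (exampleRing ⧸ Ideal.span {exampleXY}) exampleQuotX := by
  intro h
  -- x · xy² = xy · xy vanishes in the quotient; xy² = xy · r with r in R would force r = y, which
  -- is not constant at x = 0.
  have h1 : exampleQuotX * Ideal.Quotient.mk _ (exampleXMul (X 1 ^ 2)) = 0 := by
    rw [exampleQuotX, ← map_mul, Ideal.Quotient.eq_zero_iff_mem, Ideal.mem_span_singleton]
    refine ⟨exampleXY, Subtype.ext ?_⟩
    simp only [exampleXY_eq, Subring.coe_mul, coe_exampleXMul]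
    ring
  have h2 := h (h1.trans (mul_zero _).symm)
  obtain ⟨r, hr⟩ := Ideal.mem_span_singleton.1 (Ideal.Quotient.eq_zero_iff_mem.1 h2)
  have h3 : (X 0 * X 1 * X 1 : MvPowerSeries (Fin 2) ℂ) =
      X 0 * X 1 * (r : MvPowerSeries (Fin 2) ℂ) := by
    rw [mul_assoc, ← sq]
    exact congrArg Subtype.val hr
  have h4 := mul_left_cancel₀ (fun h => exampleXY_ne_zero (Subtype.ext h)) h3
  obtain ⟨c, hc⟩ := exists_setXZero_eq_C r
  rw [← h4, setXZero_X_one] at hc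
  simpa [PowerSeries.coeff_C] using congrArg (PowerSeries.coeff 1) hc

theorem isStrongParameterSequence_exampleQuotX : IsStrongParameterSequence [exampleQuotX] := by
  intro i hi hi'
  obtain rfl : i = 1 := le_antisymm hi' hi
  refine ⟨isWeaklyProregular_of_pow_mul_eq_zero [exampleQuotX].get exampleQuotX_pow_mul_eq_zero,
    ?_, fun p hp hle => ?_⟩
  · change Ideal.ofList [exampleQuotX] ≠ ⊤
    rw [Ideal.ofList_singleton, Ne, Ideal.span_singleton_eq_top]
    exact exampleQuotX_not_isUnit
  · have hx : exampleQuotX ∈ p := hle (Ideal.subset_span (by simp))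
    have : Nontrivial (CechCohomology [exampleQuotX].get 1) := by
      rw [← not_subsingleton_iff_nontrivial]
      intro h
      obtain ⟨m, a, ha⟩ := exists_pow_eq_of_subsingleton_cechCohomology [exampleQuotX].get h
      have h1 : exampleQuotX ^ m = exampleQuotX ^ (m + 1) * a := ha
      have h2 := congrArg exampleQuotSetYZero h1
      rw [map_mul, map_pow, map_pow, exampleQuotSetYZero_exampleQuotX, pow_succ, mul_assoc] at h2
      have h3 := mul_left_cancel₀ (pow_ne_zero m PowerSeries.X_ne_zero) ((mul_one _).trans h2)
      exact PowerSeries.X_prime.not_isUnit (IsUnit.of_mul_eq_one _ h3.symm)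
    -- The only prime containing x is the maximal ideal, so localizing there inverts only units.
    refine LocalizedModule.nontrivial_of_isUnit
      (M := CechCohomology [exampleQuotX].get 1) p.primeCompl fun s hs => ?_
    obtain ⟨r, rfl⟩ := Ideal.Quotient.mk_surjective s
    by_contra hu
    exact hs (exampleRing_mem_prime_of_not_isUnit
      (p := p.comap (Ideal.Quotient.mk (Ideal.span {exampleXY}))) hx
      fun h => hu (h.map (Ideal.Quotient.mk _)))

theorem not_isCohenMacaulay_quotient_exampleXY :
    ¬ IsCohenMacaulay (exampleRing ⧸ Ideal.span {exampleXY}) := by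
  intro h
  rcases h _ isStrongParameterSequence_exampleQuotX with h1 | h1
  · simp at h1
  · exact exampleQuotX_not_isSMulRegular
      ((RingTheory.Sequence.isWeaklyRegular_singleton_iff _ _).1 h1.toIsWeaklyRegular)

end ExampleProperties

theorem mainTheorem7 :
    (IsDomain exampleRing ∧ IsLocalRing exampleRing ∧ ringKrullDim exampleRing = 2 ∧
      IsCohenMacaulay exampleRing) ∧
    (exampleXY ∈ nonZeroDivisors exampleRing ∧
      ¬ IsCohenMacaulay (exampleRing ⧸ Ideal.span {exampleXY})) ∧
    ¬ (∀ (A : Type) [CommRing A] (a : A), IsCohenMacaulay A → a ∈ nonZeroDivisors A →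
      IsCohenMacaulay (A ⧸ Ideal.span {a})) := by
  have hxy := mem_nonZeroDivisors_of_ne_zero exampleXY_ne_zero
  exact ⟨⟨inferInstance, inferInstance, ringKrullDim_exampleRing, isCohenMacaulay_exampleRing⟩,
    ⟨hxy, not_isCohenMacaulay_quotient_exampleXY⟩, fun h =>
      not_isCohenMacaulay_quotient_exampleXY (h _ _ isCohenMacaulay_exampleRing hxy)⟩
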